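/- Let $N\ge 0$ and let $$P_n y^n+P_{n-1}y^{n-1}+\dots+P_0=0\qquad(*)$$ be an algebraic equation whose coefficients are polynomials in $x=(x_1,\dots,x_N)\in\mathbb C^N$. Let $\Sigma=\{x\in\mathbb C^N : P_n(x)J(x)=0\}$, where $P_n$ is the leading coefficient and $J$ the discriminant of $(*)$ with respect to $y$, and let $x_0\in\mathbb C^N\setminus\Sigma$. Let $Y_{x_0}$ be the set of all germs at $x_0$ of analytic functions satisfying $(*)$. The monodromy group of $(*)$ is the group of all permutations of $Y_{x_0}$ induced by analytic continuation along loops at $x_0$ in $\mathbb C^N\setminus\Sigma$, i.e. the image of $\pi_1(\mathbb C^N\setminus\Sigma,x_0)$ in the group of permutations of $Y_{x_0}$. Theorem. If the monodromy group of $(*)$ is solvable, then every germ $y\in Y_{x_0}$ can be represented by rational functions using root extractions and summations; that is, $Y_{x_0}$ is contained in the smallest set $A$ of germs at $x_0$ of analytic functions such that 1. $A$ contains the germs of all rational functions $p/q$ with polynomials $p,q$ and $q(x_0)\neq 0$; 2. if $f,g\in A$, then $f+g\in A$; 3. if $f$ is a germ at $x_0$ of an analytic function and $f^k\in A$ for some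 integer $k\ge 1$, then $f\in A$. In particular, if $(*)$ is irreducible over $\mathbb C(x_1,\dots,x_N)$, so that it defines a multivalued algebraic function $y(x)$ whose set of germs at $x_0$ is $Y_{x_0}$ and whose monodromy group is that of $(*)$, then $y(x)$ is represented by rational functions using root extractions and summations whenever its monodromy group is solvable. -/

import Mathlib

open scoped Topology

noncomputable section

namespace AlgFun

open Filter

/-- The singular hypersurface `Σ = {P_n · J = 0}` in `ℂ^N` of the equation
`P_n y^n + ⋯ + P_0 = 0`, whose coefficients are polynomials in `x_1, …, x_N`; here `P_n` is the
leading coefficient and `J` the discriminant with respect to `y`. -/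
def singularSet {N : ℕ} (P : Polynomial (MvPolynomial (Fin N) ℂ)) : Set (Fin N → ℂ) :=
  {x | MvPolynomial.eval x (P.leadingCoeff * P.discr) = 0}

/-- The set `Y_{x₀}` of all germs at `x₀` of analytic functions satisfying the equation. -/
def solutionGerms {N : ℕ} (P : Polynomial (MvPolynomial (Fin N) ℂ)) (x₀ : Fin N → ℂ) :
    Set (Germ (𝓝 x₀) ℂ) :=
  {f | ∃ F : (Fin N → ℂ) → ℂ, AnalyticAt ℂ F x₀ ∧ (F : Germ (𝓝 x₀) ℂ) = f ∧
    ∀ᶠ x in 𝓝 x₀, (P.map (MvPolynomial.eval x)).eval (F x) = 0}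

/-- The germ `g` at `y` is obtained from the germ `f` at `x` by analytic continuation along the
path `γ`. The continuation is given by functions `F t` analytic near `γ t`, such that the germ at
`γ s` of `F s` agrees with that of `F t` for all `s` close to `t`. -/
def IsContinuation {N : ℕ} {x y : Fin N → ℂ} (γ : Path x y)
    (f : Germ (𝓝 x) ℂ) (g : Germ (𝓝 y) ℂ) : Prop :=
  ∃ F : unitInterval → (Fin N → ℂ) → ℂ,
    (∀ t, AnalyticAt ℂ (F t) (γ t)) ∧
    (∀ t, ∀ᶠ s in 𝓝 t, F s =ᶠ[𝓝 (γ s)] F t) ∧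
    (F 0 : Germ (𝓝 x) ℂ) = f ∧ (F 1 : Germ (𝓝 y) ℂ) = g

theorem IsContinuation.refl {N : ℕ} {x : Fin N → ℂ} {F : (Fin N → ℂ) → ℂ}
    (hF : AnalyticAt ℂ F x) :
    IsContinuation (Path.refl x) (F : Germ (𝓝 x) ℂ) (F : Germ (𝓝 x) ℂ) :=
  ⟨fun _ => F, fun _ => hF, fun _ => Eventually.of_forall fun _ => EventuallyEq.rfl, rfl, rfl⟩

theorem IsContinuation.symm {N : ℕ} {x y : Fin N → ℂ} {γ : Path x y}
    {f : Germ (𝓝 x) ℂ} {g : Germ (𝓝 y) ℂ} (h : IsContinuation γ f g) :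
    IsContinuation γ.symm g f := by
  obtain ⟨F, hF, hloc, h0, h1⟩ := h
  refine ⟨fun t => F (unitInterval.symm t), fun t => hF _, fun t => ?_, by simpa using h1,
    by simpa using h0⟩
  exact (unitInterval.continuous_symm.tendsto t).eventually (hloc (unitInterval.symm t))

theorem IsContinuation.trans {N : ℕ} {x y z : Fin N → ℂ} {γ : Path x y} {δ : Path y z}
    {f : Germ (𝓝 x) ℂ} {g : Germ (𝓝 y) ℂ} {h : Germ (𝓝 z) ℂ}
    (hf : IsContinuation γ f g) (hg : IsContinuation δ g h) :
    IsContinuation (γ.trans δ) f h := by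
  obtain ⟨F, hF, hFl, hF0, hF1⟩ := hf
  obtain ⟨G, hG, hGl, hG0, hG1⟩ := hg
  let a : unitInterval → unitInterval := fun t => Set.projIcc 0 1 zero_le_one (2 * (t : ℝ))
  let b : unitInterval → unitInterval := fun t => Set.projIcc 0 1 zero_le_one (2 * (t : ℝ) - 1)
  have ha : Continuous a := continuous_projIcc.comp (by fun_prop)
  have hb : Continuous b := continuous_projIcc.comp (by fun_prop)
  have hγ : ∀ t : unitInterval, (t : ℝ) ≤ 1 / 2 → (γ.trans δ) t = γ (a t) := by
    intro t ht
    rw [Path.trans_apply, dif_pos ht]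
    congr 1
    exact (Set.projIcc_of_mem zero_le_one _).symm
  have hb0 : ∀ t : unitInterval, (t : ℝ) ≤ 1 / 2 → b t = 0 := fun t ht =>
    Set.projIcc_of_le_left _ (by linarith)
  have ha1 : ∀ t : unitInterval, 1 / 2 ≤ (t : ℝ) → a t = 1 := fun t ht =>
    Set.projIcc_of_right_le _ (by linarith)
  have hδ : ∀ t : unitInterval, ¬ (t : ℝ) ≤ 1 / 2 → (γ.trans δ) t = δ (b t) := by
    intro t ht
    rw [Path.trans_apply, dif_neg ht]
    congr 1
    exact (Set.projIcc_of_mem zero_le_one _).symm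
  have hmid : G 0 =ᶠ[𝓝 y] F 1 := Germ.coe_eq.1 (hG0.trans hF1.symm)
  refine ⟨fun t => if (t : ℝ) ≤ 1 / 2 then F (a t) else G (b t), fun t => ?_, fun t => ?_, ?_, ?_⟩
  · by_cases ht : (t : ℝ) ≤ 1 / 2
    · simpa only [if_pos ht, hγ t ht] using hF (a t)
    · simpa only [if_neg ht, hδ t ht] using hG (b t)
  · have hcoe : Tendsto (fun s : unitInterval => (s : ℝ)) (𝓝 t) (𝓝 (t : ℝ)) :=
      continuous_subtype_val.tendsto t
    have hA := (ha.tendsto t).eventually (hFl (a t))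
    have hB := (hb.tendsto t).eventually (hGl (b t))
    rcases lt_trichotomy (t : ℝ) (1 / 2) with ht | ht | ht
    · filter_upwards [hA, hcoe.eventually (gt_mem_nhds ht)] with s hs hs'
      simpa only [if_pos hs'.le, if_pos ht.le, hγ s hs'.le] using hs
    · have h1 : a t = 1 := ha1 t ht.ge
      have h0 : b t = 0 := hb0 t ht.le
      have hc : Tendsto (fun s => δ (b s)) (𝓝 t) (𝓝 y) := by
        have := (δ.continuous.comp hb).tendsto t
        simp only [Function.comp_apply, h0, δ.source] at this
        exact this
      filter_upwards [hA, hB, hc.eventually hmid.eventuallyEq_nhds] with s hs hs' hm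
      by_cases hst : (s : ℝ) ≤ 1 / 2
      · simpa only [if_pos hst, if_pos ht.le, hγ s hst] using hs
      · rw [h0] at hs'
        simpa only [if_neg hst, if_pos ht.le, hδ s hst, h1] using hs'.trans hm
    · filter_upwards [hB, hcoe.eventually (lt_mem_nhds ht)] with s hs hs'
      simpa only [if_neg hs'.not_ge, if_neg ht.not_ge, hδ s hs'.not_ge] using hs
  · have : a 0 = 0 := Set.projIcc_of_le_left _ (by simp)
    simpa [this] using hF0
  · have h1 : ¬ ((1 : unitInterval) : ℝ) ≤ 1 / 2 := by norm_num
    have : b 1 = 1 := Set.projIcc_of_right_le _ (by norm_num)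
    simpa only [if_neg h1, this] using hG1

/-- The monodromy group of the equation, with base point `x₀`: the group of those permutations of
`Y_{x₀}` which are induced by analytic continuation along the loops at `x₀` in `ℂ^N ∖ Σ`, i.e. the
image of the fundamental group of `ℂ^N ∖ Σ` in the group of permutations of `Y_{x₀}`. -/
def monodromyGroup {N : ℕ} (P : Polynomial (MvPolynomial (Fin N) ℂ)) (x₀ : Fin N → ℂ)
    (hx₀ : x₀ ∉ singularSet P) : Subgroup (Equiv.Perm (solutionGerms P x₀)) where
  carrier := {σ | ∃ γ : Path x₀ x₀, (∀ t, γ t ∉ singularSet P) ∧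
    ∀ y : solutionGerms P x₀, IsContinuation γ (y : Germ (𝓝 x₀) ℂ) (σ y : Germ (𝓝 x₀) ℂ)}
  one_mem' := by
    refine ⟨Path.refl x₀, fun _ => hx₀, ?_⟩
    rintro ⟨_, F, hF, rfl, -⟩
    exact IsContinuation.refl hF
  mul_mem' := by
    rintro σ τ ⟨γ, hγ, hσ⟩ ⟨δ, hδ, hτ⟩
    refine ⟨δ.trans γ, fun t => ?_, fun y => (hτ y).trans (hσ (τ y))⟩
    rw [Path.trans_apply]
    split_ifs
    · exact hδ _
    · exact hγ _
  inv_mem' := by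
    rintro σ ⟨γ, hγ, hσ⟩
    refine ⟨γ.symm, fun t => hγ _, fun y => ?_⟩
    have := (hσ (σ⁻¹ y)).symm
    rwa [show σ (σ⁻¹ y) = y from σ.apply_symm_apply y] at this

/-- Germs at `x₀` of analytic functions that are obtained from rational functions (regular
at `x₀`) by root extractions and summations. A root of degree `n ≥ 1` of `g` is an analytic
germ `f` with `f ^ n = g`. -/
inductive RepresentableByRootsAndSums {N : ℕ} (x₀ : Fin N → ℂ) : Germ (𝓝 x₀) ℂ → Prop
  | rational (p q : MvPolynomial (Fin N) ℂ) (hq : MvPolynomial.eval x₀ q ≠ 0) :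
      RepresentableByRootsAndSums x₀
        ((fun x => MvPolynomial.eval x p / MvPolynomial.eval x q : (Fin N → ℂ) → ℂ) :
          Germ (𝓝 x₀) ℂ)
  | sum (f g : Germ (𝓝 x₀) ℂ) (hf : RepresentableByRootsAndSums x₀ f)
      (hg : RepresentableByRootsAndSums x₀ g) : RepresentableByRootsAndSums x₀ (f + g)
  | root (n : ℕ) (hn : 0 < n) (F : (Fin N → ℂ) → ℂ) (hF : AnalyticAt ℂ F x₀)
      (h : RepresentableByRootsAndSums x₀ ((F : Germ (𝓝 x₀) ℂ) ^ n)) :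
      RepresentableByRootsAndSums x₀ (F : Germ (𝓝 x₀) ℂ)

end AlgFun

end

/-! Finitely many germs satisfy the equation, and the monodromy group Γ permutes them, hence acts on
polynomials in symbols indexed by these germs. For a solvable Γ, Lagrange resolvents descend a chain
of subgroups with cyclic quotients: an element fixed by a smaller group `M` is a sum of resolvents,
and suitable powers of these are fixed by the larger group `L`. So every such polynomial arises from
Γ-invariants by sums and roots alone, without products (`good_of_isSolvable`).

It remains to see that invariants are rational functions (`exists_rational_of_invariant`). Two
labellings of the roots over one point, both obtained by continuation from `x₀`, differ by an
element of Γ (`Reaches.exists_perm`). An invariant polynomial in the roots therefore continues to a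
single-valued function, and multiplying it by a power of P_n gives it polynomial growth. A complex
line through `x₀` meets Σ in finitely many points, so removable singularities and Liouville's
theorem bound the degree on every line. The Taylor series at `x₀` is then finite
(`exists_mvPolynomial_of_lines`). -/

noncomputable section

namespace AlgFun

open Filter

/-! ### Polynomiality from growth on complex lines -/

/-- Removable singularities at finitely many points, with a continuous bound on the norm. -/
theorem exists_differentiable_of_finite {S : Set ℂ} (hS : S.Finite) (g : ℂ → ℂ)
    (hg : ∀ t ∉ S, DifferentiableAt ℂ g t) {B : ℂ → ℝ} (hB : Continuous B)
    (hb : ∀ t ∉ S, ‖g t‖ ≤ B t) :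
    ∃ h : ℂ → ℂ, Differentiable ℂ h ∧ (∀ t ∉ S, h t = g t) ∧ ∀ t, ‖h t‖ ≤ B t := by
  induction S, hS using Set.Finite.induction_on generalizing g with
  | empty => exact ⟨g, fun t => hg t (by simp), fun _ _ => rfl, fun t => hb t (by simp)⟩
  | @insert a S ha hS ih =>
    set g₁ := Function.update g a (limUnder (𝓝[≠] a) g) with hg₁
    have hne : ∀ t, t ≠ a → g₁ t = g t := fun t ht => Function.update_of_ne ht _ _
    have hda : DifferentiableAt ℂ g₁ a := by
      set s := Sᶜ ∩ Metric.ball a 1 with hs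
      have hsn : s ∈ 𝓝 a :=
        inter_mem (hS.isClosed.isOpen_compl.mem_nhds ha) (Metric.ball_mem_nhds a one_pos)
      have hnot : ∀ z ∈ s \ {a}, z ∉ insert a S := by
        rintro z ⟨⟨hz, -⟩, hza⟩ (rfl | h)
        exacts [hza rfl, hz h]
      obtain ⟨M, hM⟩ := (isCompact_closedBall a 1).bddAbove_image hB.continuousOn
      refine (Complex.differentiableOn_update_limUnder_of_bddAbove hsn
        (fun z hz => (hg z (hnot z hz)).differentiableWithinAt) ⟨M, ?_⟩).differentiableAt hsn
      rintro _ ⟨z, hz, rfl⟩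
      exact (hb z (hnot z hz)).trans
        (hM (Set.mem_image_of_mem B (Metric.ball_subset_closedBall hz.1.2)))
    have hd : ∀ t ∉ S, DifferentiableAt ℂ g₁ t := by
      intro t ht
      by_cases hta : t = a
      · exact hta ▸ hda
      · refine (hg t (by simp [hta, ht])).congr_of_eventuallyEq ?_
        filter_upwards [isOpen_ne.mem_nhds hta] with z hz using hne z hz
    -- The continuous bound passes to the limit at `a`, so the induction can go on with `g₁`.
    have hba : ‖g₁ a‖ ≤ B a := by
      refine le_of_tendsto_of_tendsto (b := 𝓝[≠] a)
        (hda.continuousAt.norm.tendsto.mono_left nhdsWithin_le_nhds)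
        (hB.continuousAt.tendsto.mono_left nhdsWithin_le_nhds) ?_
      filter_upwards [self_mem_nhdsWithin,
        mem_nhdsWithin_of_mem_nhds (hS.isClosed.isOpen_compl.mem_nhds ha)] with z hz hzS
      rw [hne z hz]
      exact hb z (by rintro (rfl | h); exacts [hz rfl, hzS h])
    obtain ⟨h, hh, hhg, hhb⟩ := ih g₁ hd fun t ht => by
      by_cases hta : t = a
      · exact hta ▸ hba
      · rw [hne t hta]
        exact hb t (by simp [hta, ht])
    refine ⟨h, hh, fun t ht => ?_, hhb⟩
    rw [Set.mem_insert_iff, not_or] at ht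
    rw [hhg t ht.2, hne t ht.1]

/-- Liouville's theorem for entire functions of polynomial growth. -/
theorem iteratedDeriv_eq_zero_of_growth {h : ℂ → ℂ} (hd : Differentiable ℂ h) {C : ℝ} {D : ℕ}
    (hb : ∀ t, ‖h t‖ ≤ C * (1 + ‖t‖) ^ D) {k : ℕ} (hk : D < k) : iteratedDeriv k h 0 = 0 := by
  have hC : 0 ≤ C := by simpa using (norm_nonneg _).trans (hb 0)
  -- Cauchy's estimate on the circle of radius `R`; there `1 + R ≤ 2 * R`, whence the factor `2 ^
  -- D`.
  have key : ∀ R : ℝ, 1 ≤ R → ‖iteratedDeriv k h 0‖ ≤ (k.factorial * (C * 2 ^ D)) / R := by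
    intro R hR
    have hR0 : 0 < R := by linarith
    have h1 := Complex.norm_iteratedDeriv_le_of_forall_mem_sphere_norm_le (c := 0) (R := R)
      (C := C * (2 * R) ^ D) (f := h) k hR0 hd.diffContOnCl (fun z hz => by
        have hz' : ‖z‖ = R := by simpa using hz
        refine (hb z).trans ?_
        rw [hz']
        gcongr
        linarith)
    refine h1.trans ?_
    rw [mul_pow, div_le_div_iff₀ (by positivity) hR0]
    have h2 : R ^ (D + 1) ≤ R ^ k := pow_le_pow_right₀ hR hk
    calc k.factorial * (C * (2 ^ D * R ^ D)) * R
        = k.factorial * (C * 2 ^ D) * R ^ (D + 1) := by ring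
      _ ≤ k.factorial * (C * 2 ^ D) * R ^ k := by gcongr
  have hlim : Tendsto (fun R : ℝ => (k.factorial * (C * 2 ^ D)) / R) atTop (𝓝 0) :=
    tendsto_const_nhds.div_atTop tendsto_id
  have := ge_of_tendsto hlim ((eventually_ge_atTop 1).mono key)
  exact norm_le_zero_iff.1 this

/-- Homogeneous terms of a power series in finitely many variables are polynomials. -/
theorem exists_mvPolynomial_eq_multilinear {N k : ℕ}
    (f : ContinuousMultilinearMap ℂ (fun _ : Fin k => Fin N → ℂ) ℂ) :
    ∃ q : MvPolynomial (Fin N) ℂ, ∀ v, MvPolynomial.eval v q = f fun _ => v := by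
  refine ⟨∑ r : Fin k → Fin N,
    (∏ j, MvPolynomial.X (r j)) * MvPolynomial.C (f fun j => Pi.single (r j) 1), fun v => ?_⟩
  have hv : (fun _ : Fin k => v) = fun _ => ∑ i, v i • (Pi.single i 1 : Fin N → ℂ) := by
    funext _
    exact pi_eq_sum_univ' v
  rw [hv, ContinuousMultilinearMap.map_sum]
  simp [ContinuousMultilinearMap.map_smul_univ]

/-- An analytic germ whose restrictions to all complex lines extend to entire functions of
uniformly bounded polynomial growth is the germ of a polynomial. -/
theorem exists_mvPolynomial_of_lines {N : ℕ} {x₀ : Fin N → ℂ} {G : (Fin N → ℂ) → ℂ}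
    (hG : AnalyticAt ℂ G x₀) (D : ℕ)
    (hline : ∀ v : Fin N → ℂ, ∃ h : ℂ → ℂ, ∃ C : ℝ, Differentiable ℂ h ∧
      (∀ᶠ t in 𝓝 (0 : ℂ), h t = G (x₀ + t • v)) ∧ ∀ t, ‖h t‖ ≤ C * (1 + ‖t‖) ^ D) :
    ∃ q : MvPolynomial (Fin N) ℂ, ∀ᶠ x in 𝓝 x₀, G x = MvPolynomial.eval x q := by
  obtain ⟨p, hp⟩ := hG
  -- The value of `p k` on the diagonal at `v` is the `k`-th Taylor coefficient of the entire
  -- function on the line in direction `v`. The constant `C` may depend on `v`, but `D` does not.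
  have hzero : ∀ k, D < k → ∀ v, (p k fun _ => v) = 0 := by
    intro k hk v
    obtain ⟨h, C, hd, hhG, hb⟩ := hline v
    have h1 : HasFPowerSeriesAt (fun y => G (x₀ + y)) p 0 := by
      have := hp.comp_sub (-x₀)
      simpa [add_comm] using this
    let u : ℂ →L[ℂ] (Fin N → ℂ) := ContinuousLinearMap.toSpanSingleton ℂ v
    have h2 : HasFPowerSeriesAt ((fun y => G (x₀ + y)) ∘ u) (p.compContinuousLinearMap u) 0 :=
      HasFPowerSeriesAt.compContinuousLinearMap (by simpa using h1)
    have h3 : HasFPowerSeriesAt h (p.compContinuousLinearMap u) 0 := by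
      refine h2.congr ?_
      filter_upwards [hhG] with t ht
      simp [u, ht]
    have h4 := h3.eq_formalMultilinearSeries (hd.analyticAt 0).hasFPowerSeriesAt
    have h5 : (p k fun _ => v) = p.compContinuousLinearMap u k fun _ => 1 := by
      rw [FormalMultilinearSeries.compContinuousLinearMap_apply]
      simp [u, Function.comp_def]
    rw [h5, h4]
    simp [iteratedDeriv_eq_zero_of_growth hd hb hk]
  choose q hq using fun k => exists_mvPolynomial_eq_multilinear (p k)
  let τ : MvPolynomial (Fin N) ℂ →ₐ[ℂ] MvPolynomial (Fin N) ℂ :=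
    MvPolynomial.aeval fun i => MvPolynomial.X i - MvPolynomial.C (x₀ i)
  have hτ : ∀ x r, MvPolynomial.eval x (τ r) = MvPolynomial.eval (x - x₀) r := by
    intro x r
    have : ((MvPolynomial.aeval x).comp τ : MvPolynomial (Fin N) ℂ →ₐ[ℂ] ℂ) =
        MvPolynomial.aeval (x - x₀) := by
      ext i
      simp [τ]
    simpa [MvPolynomial.coe_aeval_eq_eval] using DFunLike.congr_fun this r
  refine ⟨τ (∑ k ∈ Finset.range (D + 1), q k), ?_⟩
  have hev : Tendsto (fun x => x - x₀) (𝓝 x₀) (𝓝 0) := by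
    have : ContinuousAt (fun x : Fin N → ℂ => x - x₀) x₀ := by fun_prop
    simpa [ContinuousAt] using this
  filter_upwards [hev.eventually hp.eventually_hasSum] with x hx
  rw [hτ, map_sum, add_sub_cancel] at *
  refine hx.unique ?_
  simp only [hq]
  refine hasSum_sum_of_ne_finset_zero fun k hk => hzero k ?_ _
  simpa using hk

/-- Polynomials have polynomial growth. -/
theorem exists_growth_mvPolynomial {N : ℕ} (q : MvPolynomial (Fin N) ℂ) :
    ∃ C : ℝ, ∃ D : ℕ, ∀ x, ‖MvPolynomial.eval x q‖ ≤ C * (1 + ‖x‖) ^ D := by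
  have hpos : ∀ {C : ℝ} {D : ℕ} {q : MvPolynomial (Fin N) ℂ},
      (∀ x, ‖MvPolynomial.eval x q‖ ≤ C * (1 + ‖x‖) ^ D) → 0 ≤ C := fun h => by
    simpa using (norm_nonneg _).trans (h 0)
  induction q using MvPolynomial.induction_on with
  | C a => exact ⟨‖a‖, 0, fun x => by simp⟩
  | add p q hp hq =>
    obtain ⟨C, D, hC⟩ := hp
    obtain ⟨C', D', hC'⟩ := hq
    have h0 := hpos hC
    have h0' := hpos hC'
    refine ⟨C + C', D + D', fun x => ?_⟩
    have h1 : 1 ≤ 1 + ‖x‖ := by simp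
    rw [map_add, add_mul]
    refine (norm_add_le _ _).trans (add_le_add ((hC x).trans ?_) ((hC' x).trans ?_))
    · gcongr; omega
    · gcongr; omega
  | mul_X p i hp =>
    obtain ⟨C, D, hC⟩ := hp
    have h0 := hpos hC
    refine ⟨C, D + 1, fun x => ?_⟩
    rw [map_mul, MvPolynomial.eval_X, norm_mul, pow_succ, ← mul_assoc]
    have := norm_le_pi_norm x i
    gcongr
    · exact hC x
    · linarith

/-! ### Lagrange resolvents and solvable groups -/

section LagrangeResolvents

variable {Γ A : Type*} [Group Γ] [CommRing A] [Algebra ℂ A] (ρ : Γ →* (A →ₐ[ℂ] A))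

/-- The subgroup of the elements that fix `a`. -/
def fixer (a : A) : Subgroup Γ where
  carrier := {g | ρ g a = a}
  one_mem' := by simp
  mul_mem' := by
    intro g h (hg : ρ g a = a) (hh : ρ h a = a)
    simp [hg, hh]
  inv_mem' := by
    intro g (hg : ρ g a = a)
    have : ρ g⁻¹ (ρ g a) = a := by
      rw [← AlgHom.mul_apply, ← map_mul]
      simp
    rwa [hg] at this

theorem mem_fixer {a : A} {g : Γ} : g ∈ fixer ρ a ↔ ρ g a = a := Iff.rfl

/-- The Lagrange resolvent of `a` for `h` and the root of unity `u`. -/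
def resolvent (h : Γ) (u : ℂ) (a : A) : A :=
  ∑ k ∈ Finset.range (orderOf h), u ^ k • ρ (h ^ k) a

theorem smul_apply_resolvent (h : Γ) {u : ℂ} (hu : u ^ orderOf h = 1) (a : A) :
    u • ρ h (resolvent ρ h u a) = resolvent ρ h u a := by
  have h1 : u • ρ h (resolvent ρ h u a) =
      ∑ k ∈ Finset.range (orderOf h), u ^ (k + 1) • ρ (h ^ (k + 1)) a := by
    rw [resolvent, map_sum, Finset.smul_sum]
    refine Finset.sum_congr rfl fun k _ => ?_
    rw [map_smul, smul_smul, pow_succ' u, pow_succ' h, map_mul, AlgHom.mul_apply]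
  -- The sum of `orderOf h + 1` terms is split at its last and at its first term; both equal `a`,
  -- because `u` and `h` have trivial `orderOf h`-th power.
  have h2 := Finset.sum_range_succ (fun k => u ^ k • ρ (h ^ k) a) (orderOf h)
  rw [Finset.sum_range_succ', hu, pow_orderOf_eq_one, pow_zero, pow_zero] at h2
  rw [h1]
  exact add_right_cancel h2

/-- Summing over `j` first, the coefficient of the `k`-th translate is a geometric sum in `ζ ^ k ≠
1` for `k ≠ 0` and vanishes; only `k = 0` survives. -/
theorem sum_resolvent [Finite Γ] (h : Γ) {ζ : ℂ} (hζ : IsPrimitiveRoot ζ (orderOf h)) (a : A) :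
    ∑ j ∈ Finset.range (orderOf h), resolvent ρ h (ζ ^ j) a = (orderOf h : ℂ) • a := by
  have hpos : 0 < orderOf h := orderOf_pos h
  simp only [resolvent]
  rw [Finset.sum_comm, Finset.sum_eq_single_of_mem 0 (Finset.mem_range.2 hpos)]
  · simp [Nat.cast_smul_eq_nsmul]
  · intro k hk hk0
    rw [← Finset.sum_smul]
    have h1 : ζ ^ k ≠ 1 := hζ.pow_ne_one_of_pos_of_lt hk0 (Finset.mem_range.1 hk)
    have h2 : (ζ ^ k - 1) * ∑ j ∈ Finset.range (orderOf h), (ζ ^ k) ^ j = 0 := by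
      rw [mul_geom_sum, ← pow_mul, mul_comm k, pow_mul, hζ.pow_eq_one, one_pow, sub_self]
    have h3 := (mul_eq_zero.1 h2).resolve_left (sub_ne_zero.2 h1)
    simp only [← pow_mul] at h3 ⊢
    simp only [mul_comm k] at h3
    rw [h3, zero_smul]

variable [Finite Γ] {Good : A → Prop} (hadd : ∀ a b, Good a → Good b → Good (a + b))
  (hroot : ∀ a (n : ℕ), 0 < n → Good (a ^ n) → Good a)

include hadd hroot

/-- Passing from the invariants of a group to those of a normal subgroup with cyclic quotient. -/
theorem good_of_cyclic_quotient {M L : Subgroup Γ} {h : Γ} (hL : M ⊔ Subgroup.zpowers h = L)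
    (hnorm : ∀ m ∈ M, ∀ l ∈ L, l * m * l⁻¹ ∈ M) (hgood : ∀ a, L ≤ fixer ρ a → Good a)
    {a : A} (ha : M ≤ fixer ρ a) : Good a := by
  have hpos : 0 < orderOf h := orderOf_pos h
  have hhL : h ∈ L := hL ▸ Subgroup.mem_sup_right (Subgroup.mem_zpowers h)
  have hζ := Complex.isPrimitiveRoot_exp (orderOf h) hpos.ne'
  set ζ := Complex.exp (2 * Real.pi * Complex.I / orderOf h)
  have hzero : Good 0 := hgood 0 fun g _ => by simp [mem_fixer]
  -- Dividing by the order in advance makes the resolvents of `b` sum to `a` itself, so no scalar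
  -- multiples are needed afterwards.
  set b : A := (orderOf h : ℂ)⁻¹ • a with hb
  have hbM : ∀ m ∈ M, ρ m b = b := fun m hm => by rw [hb, map_smul, (mem_fixer ρ).1 (ha hm)]
  have hres : ∀ j, Good (resolvent ρ h (ζ ^ j) b) := by
    intro j
    have hu : (ζ ^ j) ^ orderOf h = 1 := by
      rw [← pow_mul, mul_comm, pow_mul, hζ.pow_eq_one, one_pow]
    -- `M` fixes the resolvent since `h` normalizes `M`, and `h` only multiplies it by a root of
    -- unity; so its `orderOf h`-th power is fixed by `L`.
    refine hroot _ _ hpos (hgood _ ?_)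
    rw [← hL, sup_le_iff, Subgroup.zpowers_le]
    constructor
    · intro m hm
      rw [mem_fixer, map_pow]
      congr 1
      rw [resolvent, map_sum]
      refine Finset.sum_congr rfl fun k _ => ?_
      have h1 : m * h ^ k = h ^ k * ((h ^ k)⁻¹ * m * (h ^ k)⁻¹⁻¹) := by group
      rw [map_smul, ← AlgHom.mul_apply, ← map_mul, h1, map_mul, AlgHom.mul_apply,
        hbM _ (hnorm m hm _ (L.inv_mem (L.pow_mem hhL k)))]
    · rw [mem_fixer, map_pow]
      conv_rhs => rw [← smul_apply_resolvent ρ h hu b, smul_pow, hu, one_smul]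
  have hsum : a = ∑ j ∈ Finset.range (orderOf h), resolvent ρ h (ζ ^ j) b := by
    rw [sum_resolvent ρ h hζ, hb, smul_smul, mul_inv_cancel₀ (by exact_mod_cast hpos.ne'),
      one_smul]
  rw [hsum]
  exact Finset.sum_induction _ Good hadd hzero fun j _ => hres j

/-- If a finite solvable group acts on an algebra, all elements are obtained from the invariants
by sums and root extractions. -/
theorem good_of_isSolvable [Group.IsSolvable Γ]
    (hinv : ∀ a, (∀ g, ρ g a = a) → Good a) (a : A) : Good a := by
  have key : ∀ L : Subgroup Γ, (∀ a, L ≤ fixer ρ a → Good a) → ∀ a, Good a := by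
    intro L
    induction L using WellFoundedLT.induction with
    | ind L ih =>
      intro hgood
      by_cases hbot : L = ⊥
      · exact fun a => hgood a (by simp [hbot])
      · have hlt : ⁅L, L⁆ < L := Group.IsSolvable.commutator_lt_of_ne_bot hbot
        -- Any `M` containing the commutator of `L` is normal in `L`; maximality makes `M` and any
        -- `h` in `L` outside `M` generate `L`.
        obtain ⟨M, hM⟩ := (Set.toFinite {M : Subgroup Γ | ⁅L, L⁆ ≤ M ∧ M < L}).exists_maximal
          ⟨_, le_rfl, hlt⟩
        obtain ⟨hcM, hML⟩ := hM.prop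
        obtain ⟨h, hhL, hhM⟩ := SetLike.exists_of_lt hML
        refine ih M hML fun a ha => good_of_cyclic_quotient ρ hadd hroot (h := h) (L := L) ?_
          (fun m hm l hl => ?_) hgood ha
        · have hle : M ⊔ Subgroup.zpowers h ≤ L :=
            sup_le hML.le (Subgroup.zpowers_le.2 hhL)
          refine hle.eq_or_lt.resolve_right fun hlt' => hhM ?_
          exact hM.le_of_ge ⟨hcM.trans le_sup_left, hlt'⟩ le_sup_left
            (Subgroup.mem_sup_right (Subgroup.mem_zpowers h))
        · have h1 : l * m * l⁻¹ * m⁻¹ ∈ M :=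
            hcM (Subgroup.commutator_mem_commutator hl (hML.le hm))
          simpa using M.mul_mem h1 hm
  exact key ⊤ (fun a ha => hinv a fun g => ha (Subgroup.mem_top g)) a

end LagrangeResolvents

/-! ### Roots outside the singular set -/

variable {N : ℕ} {P : Polynomial (MvPolynomial (Fin N) ℂ)} {x : Fin N → ℂ}

theorem notMem_singularSet_iff : x ∉ singularSet P ↔
    MvPolynomial.eval x P.leadingCoeff ≠ 0 ∧ MvPolynomial.eval x P.discr ≠ 0 := by
  simp [singularSet, not_or]

theorem isClosed_singularSet : IsClosed (singularSet P) :=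
  isClosed_eq (MvPolynomial.continuous_eval _) continuous_const

theorem natDegree_map_eval (hx : x ∉ singularSet P) :
    (P.map (MvPolynomial.eval x)).natDegree = P.natDegree :=
  Polynomial.natDegree_map_of_leadingCoeff_ne_zero _ (notMem_singularSet_iff.1 hx).1

theorem map_eval_ne_zero (hx : x ∉ singularSet P) : P.map (MvPolynomial.eval x) ≠ 0 := fun h =>
  (notMem_singularSet_iff.1 hx).1 (by
    simpa using congrArg (fun p => Polynomial.coeff p P.natDegree) h)

/-- Up to sign, the resultant with the derivative is the leading coefficient times the discriminant,
and both survive evaluation. Degree zero is separate: the polynomial is then a nonzero constant. -/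
theorem separable_map_eval (hx : x ∉ singularSet P) :
    (P.map (MvPolynomial.eval x)).Separable := by
  have hdeg := natDegree_map_eval hx
  have hne := map_eval_ne_zero hx
  obtain ⟨hl, hd⟩ := notMem_singularSet_iff.1 hx
  rcases Nat.eq_zero_or_pos P.natDegree with h0 | h0
  · rw [h0] at hdeg
    rw [Polynomial.eq_C_of_natDegree_eq_zero hdeg, Polynomial.separable_C, isUnit_iff_ne_zero]
    intro h
    exact hne (by rw [Polynomial.eq_C_of_natDegree_eq_zero hdeg, h, map_zero])
  · have h1 := congrArg (MvPolynomial.eval x)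
      (Polynomial.resultant_deriv (Polynomial.natDegree_pos_iff_degree_pos.1 h0))
    rw [← Polynomial.resultant_map_map, ← Polynomial.derivative_map] at h1
    have h2 : Polynomial.resultant (P.map (MvPolynomial.eval x))
        (P.map (MvPolynomial.eval x)).derivative ≠ 0 := by
      rw [Polynomial.natDegree_derivative, hdeg, h1]
      simp [hl, hd]
    by_contra hsep
    exact h2 (Polynomial.resultant_eq_zero_iff.2 ⟨Or.inl hne, hsep⟩)

theorem card_roots_map_eval (hx : x ∉ singularSet P) :
    (P.map (MvPolynomial.eval x)).roots.toFinset.card = P.natDegree := by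
  rw [Multiset.toFinset_card_of_nodup (Polynomial.nodup_roots (separable_map_eval hx)),
    ← natDegree_map_eval hx]
  exact (IsAlgClosed.splits _).natDegree_eq_card_roots.symm

theorem mem_roots_map_eval (hx : x ∉ singularSet P) {y : ℂ} :
    y ∈ (P.map (MvPolynomial.eval x)).roots.toFinset ↔
      (P.map (MvPolynomial.eval x)).eval y = 0 := by
  rw [Multiset.mem_toFinset, Polynomial.mem_roots (map_eval_ne_zero hx), Polynomial.IsRoot]

theorem analyticAt_mvPolynomial_eval {E σ : Type*} [NormedAddCommGroup E] [NormedSpace ℂ E]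
    [Fintype σ] {f : E → σ → ℂ} {e : E} (hf : ∀ i, AnalyticAt ℂ (fun e => f e i) e)
    (p : MvPolynomial σ ℂ) : AnalyticAt ℂ (fun e => MvPolynomial.eval (f e) p) e := by
  simpa [MvPolynomial.coe_aeval_eq_eval] using AnalyticAt.aeval_mvPolynomial hf p

theorem analyticAt_eval_eval (P : Polynomial (MvPolynomial (Fin N) ℂ)) (z : (Fin N → ℂ) × ℂ) :
    AnalyticAt ℂ (fun z : (Fin N → ℂ) × ℂ => (P.map (MvPolynomial.eval z.1)).eval z.2) z := by
  simp only [Polynomial.eval_map, Polynomial.eval₂_eq_sum_range]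
  refine Finset.analyticAt_fun_sum _ fun k _ => AnalyticAt.mul ?_ (analyticAt_snd.pow k)
  refine analyticAt_mvPolynomial_eval (fun i => ?_) _
  exact ((ContinuousLinearMap.proj (R := ℂ) (φ := fun _ : Fin N => ℂ) i).comp
    (ContinuousLinearMap.fst ℂ (Fin N → ℂ) ℂ)).analyticAt z

/-- Near a simple root, the equation defines a unique analytic function. -/
theorem exists_root_function (hx : x ∉ singularSet P) {y : ℂ}
    (h0 : (P.map (MvPolynomial.eval x)).eval y = 0) :
    ∃ F : (Fin N → ℂ) → ℂ, AnalyticAt ℂ F x ∧ F x = y ∧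
      (∀ᶠ x' in 𝓝 x, (P.map (MvPolynomial.eval x')).eval (F x') = 0) ∧
      ∀ᶠ z in 𝓝 (x, y), (P.map (MvPolynomial.eval z.1)).eval z.2 = 0 → z.2 = F z.1 := by
  have h1 : (P.map (MvPolynomial.eval x)).derivative.eval y ≠ 0 :=
    (separable_map_eval hx).eval₂_derivative_ne_zero (RingHom.id ℂ) h0
  set f : (Fin N → ℂ) × ℂ → ℂ := fun z => (P.map (MvPolynomial.eval z.1)).eval z.2 with hf
  have hcd : ContDiffAt ℂ ⊤ f (x, y) := (analyticAt_eval_eval P (x, y)).contDiffAt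
  -- The partial derivative in `y` is multiplication by the derivative of the polynomial at a simple
  -- root, so the implicit function theorem applies.
  have hinv : (fderiv ℂ f (x, y) ∘L .inr ℂ (Fin N → ℂ) ℂ).IsInvertible := by
    refine ⟨ContinuousLinearEquiv.unitsEquivAut ℂ (Units.mk0 _ h1), ?_⟩
    have hd : HasFDerivAt (fun w : ℂ => f (x, w))
        (fderiv ℂ f (x, y) ∘L .inr ℂ (Fin N → ℂ) ℂ) y :=
      (analyticAt_eval_eval P (x, y)).differentiableAt.hasFDerivAt.comp y
        (hasFDerivAt_prodMk_right x y)
    rw [hd.unique ((P.map (MvPolynomial.eval x)).hasDerivAt y).hasFDerivAt]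
    ext
    simp
  have hfy : f (x, y) = 0 := h0
  have htop : (⊤ : WithTop ℕ∞) ≠ 0 := by simp
  refine ⟨hcd.implicitFunction htop hinv, (hcd.contDiffAt_implicitFunction htop hinv).analyticAt,
    hcd.implicitFunction_apply_self htop hinv, ?_, ?_⟩
  · filter_upwards [hcd.eventually_apply_implicitFunction htop hinv] with x' hx'
    rw [← hfy, ← hx']
  · filter_upwards [hcd.eventually_apply_eq_iff_implicitFunction htop hinv] with z hz h
    exact (hz.1 (by rw [hfy]; exact h)).symm

/-- Two root functions that are continuous and agree at a point agree near this point. -/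
theorem eventuallyEq_of_root {F G : (Fin N → ℂ) → ℂ} (hx : x ∉ singularSet P)
    (hF : ContinuousAt F x) (hG : ContinuousAt G x)
    (hF0 : ∀ᶠ x' in 𝓝 x, (P.map (MvPolynomial.eval x')).eval (F x') = 0)
    (hG0 : ∀ᶠ x' in 𝓝 x, (P.map (MvPolynomial.eval x')).eval (G x') = 0)
    (h : F x = G x) : F =ᶠ[𝓝 x] G := by
  obtain ⟨H, -, -, -, hH⟩ := exists_root_function hx hF0.self_of_nhds
  have h1 : Tendsto (fun x' => (x', F x')) (𝓝 x) (𝓝 (x, F x)) := by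
    rw [nhds_prod_eq]; exact tendsto_id.prodMk hF
  have h2 : Tendsto (fun x' => (x', G x')) (𝓝 x) (𝓝 (x, F x)) := by
    rw [nhds_prod_eq, h]; exact tendsto_id.prodMk hG
  filter_upwards [h1.eventually hH, h2.eventually hH, hF0, hG0] with x' a b c d
  exact (a c).trans (b d).symm

/-- Outside the singular set, the roots are locally the values of analytic functions. -/
theorem exists_local_roots (hx : x ∉ singularSet P) :
    ∃ F : Fin P.natDegree → (Fin N → ℂ) → ℂ, ∃ ε > 0, ∀ x' ∈ Metric.ball x ε,
      x' ∉ singularSet P ∧ (∀ k, AnalyticAt ℂ (F k) x') ∧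
      (∀ k, (P.map (MvPolynomial.eval x')).eval (F k x') = 0) ∧
      (Function.Injective fun k => F k x') ∧
      ∀ y, (P.map (MvPolynomial.eval x')).eval y = 0 → ∃ k, F k x' = y := by
  let e : Fin P.natDegree ≃ (P.map (MvPolynomial.eval x)).roots.toFinset :=
    (Finset.equivFinOfCardEq (card_roots_map_eval hx)).symm
  choose F hFa hFx hFr _ using fun k =>
    exists_root_function hx ((mem_roots_map_eval hx).1 (e k).2)
  have hinj : ∀ᶠ x' in 𝓝 x, ∀ i j, i ≠ j → F i x' ≠ F j x' := by
    refine eventually_all.2 fun i => eventually_all.2 fun j => ?_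
    by_cases hij : i = j
    · simp [hij]
    · have : F i x ≠ F j x := by
        rw [hFx, hFx]
        exact fun h => hij (e.injective (Subtype.ext h))
      filter_upwards [((hFa i).continuousAt.sub (hFa j).continuousAt).eventually_ne
        (sub_ne_zero.2 this)] with x' h _ using sub_ne_zero.1 h
  have hall : ∀ᶠ x' in 𝓝 x, x' ∉ singularSet P ∧ (∀ k, AnalyticAt ℂ (F k) x') ∧
      (∀ k, (P.map (MvPolynomial.eval x')).eval (F k x') = 0) ∧
      (∀ i j, i ≠ j → F i x' ≠ F j x') :=
    (isClosed_singularSet.isOpen_compl.eventually_mem hx).and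
      ((eventually_all.2 fun k => (hFa k).eventually_analyticAt).and
        ((eventually_all.2 hFr).and hinj))
  obtain ⟨ε, hε, hball⟩ := Metric.eventually_nhds_iff_ball.1 hall
  refine ⟨F, ε, hε, fun x' hx' => ?_⟩
  obtain ⟨h1, h2, h3, h4⟩ := hball x' hx'
  have hinj' : Function.Injective fun k => F k x' := fun i j hij => by
    by_contra hne
    exact h4 i j hne hij
  refine ⟨h1, h2, h3, hinj', fun y hy => ?_⟩
  -- The branches give as many distinct roots as the degree allows, hence all of them.
  have himg : Finset.univ.image (fun k => F k x') =
      (P.map (MvPolynomial.eval x')).roots.toFinset := by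
    refine Finset.eq_of_subset_of_card_le (fun z hz => ?_) ?_
    · obtain ⟨k, -, rfl⟩ := Finset.mem_image.1 hz
      exact (mem_roots_map_eval h1).2 (h3 k)
    · rw [card_roots_map_eval h1, Finset.card_image_of_injective _ hinj', Finset.card_univ,
        Fintype.card_fin]
  have := (mem_roots_map_eval h1).2 hy
  rw [← himg, Finset.mem_image] at this
  obtain ⟨k, -, hk⟩ := this
  exact ⟨k, hk⟩

/-- Polynomial bound on the roots multiplied by the leading coefficient. -/
theorem exists_growth_roots (P : Polynomial (MvPolynomial (Fin N) ℂ)) :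
    ∃ C : ℝ, ∃ D : ℕ, 0 ≤ C ∧ ∀ x ∉ singularSet P,
      ‖MvPolynomial.eval x P.leadingCoeff‖ ≤ C * (1 + ‖x‖) ^ D ∧
      ∀ y, (P.map (MvPolynomial.eval x)).eval y = 0 →
        ‖MvPolynomial.eval x P.leadingCoeff * y‖ ≤ C * (1 + ‖x‖) ^ D := by
  choose C D hCD using fun k => exists_growth_mvPolynomial (P.coeff k)
  have hC0 : ∀ k, 0 ≤ C k := fun k => by simpa using (norm_nonneg _).trans (hCD k 0)
  set n := P.natDegree
  set C' := ∑ k ∈ Finset.range (n + 1), C k with hC'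
  set D' := ∑ k ∈ Finset.range (n + 1), D k with hD'
  have hC'0 : 0 ≤ C' := Finset.sum_nonneg fun k _ => hC0 k
  have hk : ∀ k ∈ Finset.range (n + 1), ∀ x,
      ‖MvPolynomial.eval x (P.coeff k)‖ ≤ C' * (1 + ‖x‖) ^ D' := by
    intro k hk x
    refine (hCD k x).trans ?_
    have h1 : 1 ≤ 1 + ‖x‖ := by simp
    have h2 : C k ≤ C' := Finset.single_le_sum (fun i _ => hC0 i) hk
    have h3 : D k ≤ D' := Finset.single_le_sum (fun i _ => Nat.zero_le _) hk
    gcongr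
  -- Cauchy's bound times the leading coefficient is the largest lower coefficient plus the leading
  -- one; each contributes one `C'`.
  refine ⟨2 * C', D', by positivity, fun x hx => ?_⟩
  have hn : n ∈ Finset.range (n + 1) := by simp
  have hlc := hk n hn x
  rw [Polynomial.coeff_natDegree] at hlc
  have hB0 : 0 ≤ C' * (1 + ‖x‖) ^ D' := by positivity
  refine ⟨by linarith, fun y hy => ?_⟩
  have hl := (notMem_singularSet_iff.1 hx).1
  have hlc' : (P.map (MvPolynomial.eval x)).leadingCoeff = MvPolynomial.eval x P.leadingCoeff := by
    rw [Polynomial.leadingCoeff, natDegree_map_eval hx, Polynomial.coeff_map]; rfl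
  have h1 : ‖y‖ ≤ _ :=
    NNReal.coe_le_coe.2 (Polynomial.IsRoot.norm_lt_cauchyBound (map_eval_ne_zero hx) hy).le
  rw [Polynomial.cauchyBound, hlc', natDegree_map_eval hx, NNReal.coe_add, NNReal.coe_div] at h1
  have hpos : 0 < ‖MvPolynomial.eval x P.leadingCoeff‖ := norm_pos_iff.2 hl
  have hsup : (((Finset.range n).sup fun k => ‖(P.map (MvPolynomial.eval x)).coeff k‖₊ : NNReal) : ℝ)
      ≤ C' * (1 + ‖x‖) ^ D' := by
    rw [← NNReal.coe_mk _ hB0, NNReal.coe_le_coe, Finset.sup_le_iff]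
    intro k hkn
    rw [Polynomial.coeff_map, ← NNReal.coe_le_coe]
    exact hk k (Finset.mem_range.2 (by have := Finset.mem_range.1 hkn; omega)) x
  rw [norm_mul]
  calc _ ≤ ‖MvPolynomial.eval x P.leadingCoeff‖ * _ := mul_le_mul_of_nonneg_left h1 hpos.le
    _ = _ + ‖MvPolynomial.eval x P.leadingCoeff‖ := by
      rw [mul_add, coe_nnnorm, mul_div_cancel₀ _ hpos.ne', NNReal.coe_one, mul_one]
    _ ≤ _ := by linarith

/-! ### Solution germs and continuation of labelled roots -/

variable {x₀ : Fin N → ℂ}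

/-- An analytic function representing a solution germ. -/
def rep (y : solutionGerms P x₀) : (Fin N → ℂ) → ℂ := y.2.choose

theorem analyticAt_rep (y : solutionGerms P x₀) : AnalyticAt ℂ (rep y) x₀ := y.2.choose_spec.1

theorem coe_rep (y : solutionGerms P x₀) : (rep y : Germ (𝓝 x₀) ℂ) = y := y.2.choose_spec.2.1

theorem eventually_eval_rep (y : solutionGerms P x₀) :
    ∀ᶠ x in 𝓝 x₀, (P.map (MvPolynomial.eval x)).eval (rep y x) = 0 := y.2.choose_spec.2.2

theorem rep_injective (hx₀ : x₀ ∉ singularSet P) :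
    Function.Injective fun y : solutionGerms P x₀ => rep y x₀ := by
  intro y z h
  refine Subtype.ext ?_
  rw [← coe_rep y, ← coe_rep z]
  exact Germ.coe_eq.2 (eventuallyEq_of_root hx₀ (analyticAt_rep y).continuousAt
    (analyticAt_rep z).continuousAt (eventually_eval_rep y) (eventually_eval_rep z) h)

theorem exists_rep_eq (hx₀ : x₀ ∉ singularSet P) {w : ℂ}
    (hw : (P.map (MvPolynomial.eval x₀)).eval w = 0) : ∃ y : solutionGerms P x₀, rep y x₀ = w := by
  obtain ⟨F, hF, hFx, hF0, -⟩ := exists_root_function hx₀ hw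
  let y : solutionGerms P x₀ := ⟨F, F, hF, rfl, hF0⟩
  have hy : rep y =ᶠ[𝓝 x₀] F := Germ.coe_eq.1 (coe_rep y)
  exact ⟨y, hy.self_of_nhds.trans hFx⟩

/-- Solution germs correspond to the roots at the base point. -/
def solutionGermsEquiv (hx₀ : x₀ ∉ singularSet P) :
    solutionGerms P x₀ ≃ (P.map (MvPolynomial.eval x₀)).roots.toFinset :=
  Equiv.ofBijective
    (fun y => ⟨rep y x₀, (mem_roots_map_eval hx₀).2 (eventually_eval_rep y).self_of_nhds⟩)
    ⟨fun _ _ h => rep_injective hx₀ (congrArg Subtype.val h), fun w => by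
      obtain ⟨y, hy⟩ := exists_rep_eq hx₀ ((mem_roots_map_eval hx₀).1 w.2)
      exact ⟨y, Subtype.ext hy⟩⟩

theorem finite_solutionGerms (hx₀ : x₀ ∉ singularSet P) : Finite (solutionGerms P x₀) :=
  Finite.of_equiv _ (solutionGermsEquiv hx₀).symm

theorem natCard_solutionGerms (hx₀ : x₀ ∉ singularSet P) :
    Nat.card (solutionGerms P x₀) = P.natDegree := by
  rw [Nat.card_congr (solutionGermsEquiv hx₀), Nat.card_eq_fintype_card, Fintype.card_coe,
    card_roots_map_eval hx₀]

/-- Points outside the singular set together with a labelling of distinct roots. -/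
def tupleSpace (P : Polynomial (MvPolynomial (Fin N) ℂ)) (ι : Type*) :
    Set ((Fin N → ℂ) × (ι → ℂ)) :=
  {z | z.1 ∉ singularSet P ∧ (∀ i, (P.map (MvPolynomial.eval z.1)).eval (z.2 i) = 0) ∧
    Function.Injective z.2}

theorem exists_eq_of_mem_tupleSpace {ι : Type*} [Finite ι] (hι : Nat.card ι = P.natDegree)
    {z : (Fin N → ℂ) × (ι → ℂ)} (hz : z ∈ tupleSpace P ι) {w : ℂ}
    (hw : (P.map (MvPolynomial.eval z.1)).eval w = 0) : ∃ i, z.2 i = w := by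
  have := Fintype.ofFinite ι
  have himg : Finset.univ.image z.2 = (P.map (MvPolynomial.eval z.1)).roots.toFinset := by
    refine Finset.eq_of_subset_of_card_le (fun u hu => ?_) ?_
    · obtain ⟨k, -, rfl⟩ := Finset.mem_image.1 hu
      exact (mem_roots_map_eval hz.1).2 (hz.2.1 k)
    · rw [card_roots_map_eval hz.1, Finset.card_image_of_injective _ hz.2.2, Finset.card_univ,
        ← Nat.card_eq_fintype_card, hι]
  have := (mem_roots_map_eval hz.1).2 hw
  rw [← himg, Finset.mem_image] at this
  obtain ⟨k, -, hk⟩ := this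
  exact ⟨k, hk⟩

/-- Locally, labellings of the roots are transported by analytic functions. -/
theorem exists_local_transport (hx : x ∉ singularSet P) (ι : Type*) :
    ∃ ε > 0, ∀ x₁ ∈ Metric.ball x ε, ∀ T : ι → ℂ, (x₁, T) ∈ tupleSpace P ι →
      ∃ F : ι → (Fin N → ℂ) → ℂ, (∀ i, F i x₁ = T i) ∧
        ∀ x₂ ∈ Metric.ball x ε, (∀ i, AnalyticAt ℂ (F i) x₂) ∧
          JoinedIn (tupleSpace P ι) (x₁, T) (x₂, fun i => F i x₂) := by
  obtain ⟨F, ε, hε, hF⟩ := exists_local_roots hx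
  refine ⟨ε, hε, fun x₁ hx₁ T hT => ?_⟩
  choose k hk using fun i => (hF x₁ hx₁).2.2.2.2 (T i) (hT.2.1 i)
  have hkinj : Function.Injective k := fun i j hij => hT.2.2 (by
    change T i = T j
    rw [← hk i, ← hk j, hij])
  refine ⟨fun i => F (k i), hk, fun x₂ hx₂ => ⟨fun i => (hF x₂ hx₂).2.1 _, ?_⟩⟩
  have hj : JoinedIn (Metric.ball x ε) x₁ x₂ :=
    ((convex_ball x ε).isPathConnected ⟨x₁, hx₁⟩).joinedIn x₁ hx₁ x₂ hx₂
  have hc : ContinuousOn (fun x' => (x', fun i => F (k i) x')) (Metric.ball x ε) :=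
    continuousOn_id.prodMk (continuousOn_pi.2 fun i x' hx' =>
      ((hF x' hx').2.1 (k i)).continuousAt.continuousWithinAt)
  have h2 := hj.map_continuousOn hc
  rw [funext hk] at h2
  refine h2.mono ?_
  rintro _ ⟨x', hx', rfl⟩
  obtain ⟨h1, -, h3, h4, -⟩ := hF x' hx'
  exact ⟨h1, fun i => h3 _, fun i j hij => hkinj (h4 hij)⟩

/-- A loop in the space of labellings induces an element of the monodromy group. -/
theorem mem_monodromyGroup_of_joinedIn (hx₀ : x₀ ∉ singularSet P)
    (σ : Equiv.Perm (solutionGerms P x₀))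
    (h : JoinedIn (tupleSpace P (solutionGerms P x₀)) (x₀, fun y => rep y x₀)
      (x₀, fun y => rep (σ y) x₀)) : σ ∈ monodromyGroup P x₀ hx₀ := by
  obtain ⟨Γ, hΓ⟩ := h
  let γ : Path x₀ x₀ := Γ.map continuous_fst
  refine ⟨γ, fun t => (hΓ t).1, fun y => ?_⟩
  have hη : Continuous fun t => (γ t, (Γ t).2 y) :=
    γ.continuous.prodMk ((continuous_apply y).comp (continuous_snd.comp Γ.continuous))
  -- At each time, `F t` is the branch through the current root with label `y`; local uniqueness of
  -- branches makes neighbouring choices agree.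
  choose F hFa hFx hF0 hFu using fun t =>
    exists_root_function (hΓ t).1 ((hΓ t).2.1 y)
  refine ⟨F, hFa, fun t => ?_, ?_, ?_⟩
  · filter_upwards [(hη.tendsto t).eventually (hFu t),
      (γ.continuous.tendsto t).eventually (hFa t).eventually_analyticAt,
      (γ.continuous.tendsto t).eventually (hF0 t).eventually_nhds] with s h1 h2 h3
    exact eventuallyEq_of_root (hΓ s).1 (hFa s).continuousAt h2.continuousAt (hF0 s) h3
      ((hFx s).trans (h1 ((hΓ s).2.1 y)))
  · rw [← coe_rep y, Germ.coe_eq]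
    have h0 := hFx 0
    have ha := hFa 0
    have hr := hF0 0
    rw [Γ.source] at h0 ha hr
    exact eventuallyEq_of_root hx₀ ha.continuousAt (analyticAt_rep y).continuousAt hr
      (eventually_eval_rep y) h0
  · rw [← coe_rep (σ y), Germ.coe_eq]
    have h0 := hFx 1
    have ha := hFa 1
    have hr := hF0 1
    rw [Γ.target] at h0 ha hr
    exact eventuallyEq_of_root hx₀ ha.continuousAt (analyticAt_rep (σ y)).continuousAt hr
      (eventually_eval_rep (σ y)) h0

/-- The labelling `T` of the roots at `x` is obtained from that at `x₀` by continuation. -/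
def Reaches (P : Polynomial (MvPolynomial (Fin N) ℂ)) (x₀ x : Fin N → ℂ)
    (T : solutionGerms P x₀ → ℂ) : Prop :=
  JoinedIn (tupleSpace P (solutionGerms P x₀)) (x₀, fun y => rep y x₀) (x, T)

theorem reaches_self (hx₀ : x₀ ∉ singularSet P) : Reaches P x₀ x₀ fun y => rep y x₀ :=
  JoinedIn.refl ⟨hx₀, fun y => (eventually_eval_rep y).self_of_nhds, rep_injective hx₀⟩

/-- Both labellings list all roots over `x`, so they differ by a permutation `σ`. Following the
second path out and the first one, relabelled by `σ`, back gives a path over a loop at `x₀` which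
realizes `σ`. -/
theorem Reaches.exists_perm (hx₀ : x₀ ∉ singularSet P) {T T' : solutionGerms P x₀ → ℂ}
    (h : Reaches P x₀ x T) (h' : Reaches P x₀ x T') :
    ∃ σ ∈ monodromyGroup P x₀ hx₀, T' = T ∘ σ := by
  have := finite_solutionGerms hx₀
  choose f hf using fun i => exists_eq_of_mem_tupleSpace (natCard_solutionGerms hx₀)
    h.target_mem (h'.target_mem.2.1 i)
  replace hf : ∀ i, T (f i) = T' i := hf
  have hinj : Function.Injective f := fun i j hij => h'.target_mem.2.2 (by
    change T' i = T' j
    rw [← hf i, ← hf j, hij])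
  let σ : Equiv.Perm (solutionGerms P x₀) :=
    Equiv.ofBijective f (Finite.injective_iff_bijective.1 hinj)
  have hT' : T' = T ∘ σ := funext fun i => (hf i).symm
  refine ⟨σ, mem_monodromyGroup_of_joinedIn hx₀ σ (h'.trans ?_), hT'⟩
  have hc : Continuous fun z : (Fin N → ℂ) × (solutionGerms P x₀ → ℂ) => (z.1, z.2 ∘ σ) := by
    fun_prop
  rw [hT']
  refine (h.map hc).symm.mono ?_
  rintro _ ⟨z, hz, rfl⟩
  exact ⟨hz.1, fun i => hz.2.1 (σ i), hz.2.2.comp σ.injective⟩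

theorem Reaches.exists_analytic {T : solutionGerms P x₀ → ℂ} (h : Reaches P x₀ x T) :
    ∃ F : solutionGerms P x₀ → (Fin N → ℂ) → ℂ, (∀ i, F i x = T i) ∧
      (∀ i, AnalyticAt ℂ (F i) x) ∧ ∀ᶠ x' in 𝓝 x, Reaches P x₀ x' fun i => F i x' := by
  obtain ⟨ε, hε, hloc⟩ := exists_local_transport h.target_mem.1 (solutionGerms P x₀)
  obtain ⟨F, hFx, hF⟩ := hloc x (Metric.mem_ball_self hε) T h.target_mem
  refine ⟨F, hFx, (hF x (Metric.mem_ball_self hε)).1, ?_⟩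
  filter_upwards [Metric.ball_mem_nhds x hε] with x' hx' using h.trans (hF x' hx').2

/-! ### Continuation on complex lines and rationality of invariants -/

/-- On the line, P_n · J is a polynomial in `t` that is nonzero at `t = 0`. -/
theorem finite_line_inter_singularSet (hx₀ : x₀ ∉ singularSet P) (v : Fin N → ℂ) :
    {t : ℂ | x₀ + t • v ∈ singularSet P}.Finite := by
  let q : Polynomial ℂ := MvPolynomial.aeval
    (fun i => Polynomial.C (x₀ i) + Polynomial.X * Polynomial.C (v i)) (P.leadingCoeff * P.discr)
  have hq : ∀ t, q.eval t = MvPolynomial.eval (x₀ + t • v) (P.leadingCoeff * P.discr) := by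
    intro t
    have : ((Polynomial.aeval t).comp (MvPolynomial.aeval
        fun i => Polynomial.C (x₀ i) + Polynomial.X * Polynomial.C (v i)) :
          MvPolynomial (Fin N) ℂ →ₐ[ℂ] ℂ) = MvPolynomial.aeval (x₀ + t • v) := by
      ext i
      simp [mul_comm t]
    simpa [MvPolynomial.coe_aeval_eq_eval, Polynomial.coe_aeval_eq_eval, q] using
      DFunLike.congr_fun this (P.leadingCoeff * P.discr)
  have hq0 : q ≠ 0 := by
    intro h
    refine hx₀ ?_
    have := hq 0
    rw [h] at this
    simpa [singularSet] using this.symm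
  refine (Polynomial.finite_setOfPred_isRoot hq0).subset fun t ht => ?_
  exact (hq t).trans ht

/-- The line minus finitely many points is connected, and the reachable parameters are open and
relatively closed in it: a ball in which labellings are transported either way carries reachability
to its centre. -/
theorem exists_reaches_of_line (hx₀ : x₀ ∉ singularSet P) (v : Fin N → ℂ) {t : ℂ}
    (ht : x₀ + t • v ∉ singularSet P) : ∃ T, Reaches P x₀ (x₀ + t • v) T := by
  have hconn : IsPreconnected {t : ℂ | x₀ + t • v ∈ singularSet P}ᶜ :=
    ((finite_line_inter_singularSet hx₀ v).countable.isConnected_compl_of_one_lt_rank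
      (by simp)).isPreconnected
  have hline : Continuous fun t : ℂ => x₀ + t • v := by fun_prop
  refine hconn.subset_of_closure_inter_subset (u := {t | ∃ T, Reaches P x₀ (x₀ + t • v) T})
    ?_ ⟨0, by simpa using hx₀, by simpa using ⟨_, reaches_self hx₀⟩⟩ ?_ ht
  · refine isOpen_iff_mem_nhds.2 ?_
    rintro s ⟨T, hT⟩
    obtain ⟨F, -, -, hF⟩ := hT.exists_analytic
    filter_upwards [(hline.tendsto s).eventually hF] with s' hs' using ⟨_, hs'⟩
  · rintro s ⟨hs, hs_sing⟩
    obtain ⟨ε, hε, hloc⟩ := exists_local_transport hs_sing (solutionGerms P x₀)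
    obtain ⟨s', hs', T, hT⟩ := mem_closure_iff_nhds.1 hs _
      ((hline.tendsto s) (Metric.ball_mem_nhds _ hε))
    obtain ⟨F, -, hF⟩ := hloc _ hs' T hT.target_mem
    exact ⟨_, hT.trans (hF _ (Metric.mem_ball_self hε)).2⟩

/-- Bound on polynomial expressions whose denominators have been cleared. -/
theorem norm_pow_mul_eval_le {ι : Type*} [Fintype ι] (p : MvPolynomial ι ℂ) {l : ℂ} {T : ι → ℂ}
    {b : ℝ} (hl : ‖l‖ ≤ b) (hT : ∀ i, ‖l * T i‖ ≤ b) :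
    ‖l ^ p.totalDegree * MvPolynomial.eval T p‖ ≤
      (∑ d ∈ p.support, ‖p.coeff d‖) * b ^ p.totalDegree := by
  have hb : 0 ≤ b := (norm_nonneg _).trans hl
  rw [MvPolynomial.eval_eq', Finset.mul_sum, Finset.sum_mul]
  refine norm_sum_le_of_le _ fun d hd => ?_
  have hdeg : ∑ i, d i ≤ p.totalDegree := by
    have := MvPolynomial.le_totalDegree hd
    rwa [Finsupp.sum_fintype _ _ fun _ => rfl] at this
  -- Each factor `T i` absorbs one `l`; the unused powers of `l` stay in front.
  have h1 : l ^ p.totalDegree * (p.coeff d * ∏ i, T i ^ d i) =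
      p.coeff d * (l ^ (p.totalDegree - ∑ i, d i) * ∏ i, (l * T i) ^ d i) := by
    simp only [mul_pow, Finset.prod_mul_distrib, Finset.prod_pow_eq_pow_sum]
    rw [← Nat.sub_add_cancel hdeg, pow_add, Nat.add_sub_cancel]
    ring
  have h2 : b ^ p.totalDegree = b ^ (p.totalDegree - ∑ i, d i) * ∏ i, b ^ d i := by
    rw [Finset.prod_pow_eq_pow_sum, ← pow_add, Nat.sub_add_cancel hdeg]
  rw [h1, h2, norm_mul, norm_mul, norm_pow, norm_prod]
  gcongr with i
  rw [norm_pow]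
  gcongr
  exact hT i

/-- The function given near the base point by a polynomial in the solutions. -/
def evalRep (p : MvPolynomial (solutionGerms P x₀) ℂ) (x : Fin N → ℂ) : ℂ :=
  MvPolynomial.eval (fun y => rep y x) p

/-- A polynomial in the solutions that is invariant under the monodromy group is a rational
function. -/
theorem exists_rational_of_invariant (hx₀ : x₀ ∉ singularSet P)
    (p : MvPolynomial (solutionGerms P x₀) ℂ)
    (hp : ∀ σ ∈ monodromyGroup P x₀ hx₀, MvPolynomial.rename σ p = p) :
    ∃ q r : MvPolynomial (Fin N) ℂ, MvPolynomial.eval x₀ r ≠ 0 ∧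
      ∀ᶠ x in 𝓝 x₀, evalRep p x = MvPolynomial.eval x q / MvPolynomial.eval x r := by
  classical
  have := finite_solutionGerms hx₀
  have := Fintype.ofFinite (solutionGerms P x₀)
  -- Invariance makes the value independent of the reachable labelling; the default `0` is only
  -- taken where no labelling is reachable.
  obtain ⟨g, hg⟩ : ∃ g : (Fin N → ℂ) → ℂ, ∀ x T, Reaches P x₀ x T →
      g x = MvPolynomial.eval T p := by
    refine ⟨fun x => if h : ∃ T, Reaches P x₀ x T then MvPolynomial.eval h.choose p else 0,
      fun x T hT => ?_⟩
    have hex : ∃ T, Reaches P x₀ x T := ⟨T, hT⟩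
    obtain ⟨σ, hσ, hTσ⟩ := hT.exists_perm hx₀ hex.choose_spec
    simp only [dif_pos hex]
    rw [hTσ, ← MvPolynomial.eval_rename, hp σ hσ]
  have hga : ∀ x T, Reaches P x₀ x T → AnalyticAt ℂ g x := by
    intro x T hT
    obtain ⟨F, -, hFa, hF⟩ := hT.exists_analytic
    refine (analyticAt_mvPolynomial_eval (f := fun x i => F i x) hFa p).congr ?_
    filter_upwards [hF] with x' hx' using (hg _ _ hx').symm
  have hrep : evalRep p =ᶠ[𝓝 x₀] g := by
    obtain ⟨F, hFx, hFa, hF⟩ := (reaches_self hx₀).exists_analytic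
    have hFr : ∀ᶠ x' in 𝓝 x₀, ∀ y, F y x' = rep y x' := eventually_all.2 fun y =>
      eventuallyEq_of_root hx₀ (hFa y).continuousAt (analyticAt_rep y).continuousAt
        (hF.mono fun x' hx' => hx'.target_mem.2.1 y) (eventually_eval_rep y) (hFx y)
    filter_upwards [hF, hFr] with x' h1 h2
    rw [hg _ _ h1, evalRep, funext h2]
  set m := p.totalDegree
  -- Roots may blow up where P_n vanishes; its `m`-th power compensates every monomial of `p`.
  set G : (Fin N → ℂ) → ℂ := fun x => MvPolynomial.eval x P.leadingCoeff ^ m * g x with hG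
  have hGa : ∀ x T, Reaches P x₀ x T → AnalyticAt ℂ G x := fun x T hT =>
    ((analyticAt_mvPolynomial_eval (f := fun x : Fin N → ℂ => x) (fun i =>
      (ContinuousLinearMap.proj (R := ℂ) (φ := fun _ : Fin N => ℂ) i).analyticAt x) _).pow m).mul
      (hga x T hT)
  obtain ⟨C, D, hC, hCD⟩ := exists_growth_roots P
  set M := ∑ d ∈ p.support, ‖p.coeff d‖
  have hM : 0 ≤ M := Finset.sum_nonneg fun _ _ => norm_nonneg _
  have hGb : ∀ x T, Reaches P x₀ x T → ‖G x‖ ≤ M * (C * (1 + ‖x‖) ^ D) ^ m := by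
    intro x T hT
    obtain ⟨h1, h2⟩ := hCD x hT.target_mem.1
    rw [hG]
    simp only
    rw [hg x T hT]
    exact norm_pow_mul_eval_le p h1 fun i => h2 _ (hT.target_mem.2.1 i)
  obtain ⟨q, hq⟩ := exists_mvPolynomial_of_lines (hGa x₀ _ (reaches_self hx₀)) (D * m) fun v => by
    -- Chosen so that `1 + ‖x₀ + t • v‖ ≤ B * (1 + ‖t‖)`, which turns growth in `x` into growth in
    -- `t`.
    set B : ℝ := 1 + ‖x₀‖ + ‖v‖ with hB
    have hline : Differentiable ℂ fun t : ℂ => x₀ + t • v := by fun_prop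
    obtain ⟨h, hd, hhG, hb⟩ := exists_differentiable_of_finite
      (finite_line_inter_singularSet hx₀ v) (fun t => G (x₀ + t • v)) (fun t ht => by
        obtain ⟨T, hT⟩ := exists_reaches_of_line hx₀ v ht
        exact (hGa _ T hT).differentiableAt.comp t (hline t))
      (B := fun t => M * (C * B ^ D) ^ m * (1 + ‖t‖) ^ (D * m)) (by fun_prop) (fun t ht => by
        obtain ⟨T, hT⟩ := exists_reaches_of_line hx₀ v ht
        refine (hGb _ T hT).trans ?_
        have h1 : 1 + ‖x₀ + t • v‖ ≤ B * (1 + ‖t‖) := by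
          have h2 := norm_add_le x₀ (t • v)
          rw [norm_smul] at h2
          nlinarith [norm_nonneg x₀, norm_nonneg v, norm_nonneg t,
            mul_nonneg (norm_nonneg x₀) (norm_nonneg t)]
        calc M * (C * (1 + ‖x₀ + t • v‖) ^ D) ^ m ≤ M * (C * (B * (1 + ‖t‖)) ^ D) ^ m := by gcongr
          _ = M * (C * B ^ D) ^ m * (1 + ‖t‖) ^ (D * m) := by
            rw [mul_pow B, ← mul_assoc C, mul_pow _ _ m, ← pow_mul, mul_assoc])
    refine ⟨h, _, hd, ?_, hb⟩
    filter_upwards [(finite_line_inter_singularSet hx₀ v).isClosed.isOpen_compl.mem_nhds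
      (by simpa using hx₀ : (0 : ℂ) ∈ {t : ℂ | x₀ + t • v ∈ singularSet P}ᶜ)] with t ht
      using hhG t ht
  have hlc := (notMem_singularSet_iff.1 hx₀).1
  refine ⟨q, P.leadingCoeff ^ m, by simpa using pow_ne_zero m hlc, ?_⟩
  filter_upwards [hq, hrep, (MvPolynomial.continuous_eval P.leadingCoeff).continuousAt.eventually_ne
    hlc] with x h1 h2 h3
  rw [h2, ← h1, map_pow, hG, mul_div_cancel_left₀ _ (pow_ne_zero m h3)]

/-- The action of the monodromy group on polynomials in the solutions. -/
def renameHom {ι : Type*} (Γ : Subgroup (Equiv.Perm ι)) :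
    Γ →* (MvPolynomial ι ℂ →ₐ[ℂ] MvPolynomial ι ℂ) where
  toFun σ := MvPolynomial.rename (σ : Equiv.Perm ι)
  map_one' := by ext; simp
  map_mul' σ τ := by ext; simp

end AlgFun

end

/-! ### Conclusion -/

theorem theorem2p10 (N : ℕ) (P : Polynomial (MvPolynomial (Fin N) ℂ)) (x₀ : Fin N → ℂ)
    (hx₀ : x₀ ∉ AlgFun.singularSet P) (hsolv : Group.IsSolvable (AlgFun.monodromyGroup P x₀ hx₀)) :
    ∀ y ∈ AlgFun.solutionGerms P x₀, AlgFun.RepresentableByRootsAndSums x₀ y := by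
  intro y hy
  have := AlgFun.finite_solutionGerms hx₀
  have := Fintype.ofFinite (AlgFun.solutionGerms P x₀)
  -- The group acts on formal polynomials by permuting variables, and goodness is tested on their
  -- evaluations; no action on germs by algebra maps has to be constructed.
  have key := AlgFun.good_of_isSolvable (AlgFun.renameHom (AlgFun.monodromyGroup P x₀ hx₀))
    (Good := fun p => AlgFun.RepresentableByRootsAndSums x₀
      (AlgFun.evalRep p : Filter.Germ (𝓝 x₀) ℂ)) ?_ ?_ ?_ (MvPolynomial.X ⟨y, hy⟩)
  · have hX : AlgFun.evalRep (MvPolynomial.X ⟨y, hy⟩) = AlgFun.rep ⟨y, hy⟩ := by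
      funext x
      simp [AlgFun.evalRep]
    rw [hX, AlgFun.coe_rep] at key
    exact key
  · intro a b ha hb
    have hab : AlgFun.evalRep (a + b) = AlgFun.evalRep a + AlgFun.evalRep b := by
      funext x
      simp [AlgFun.evalRep]
    rw [hab, Filter.Germ.coe_add]
    exact .sum _ _ ha hb
  · intro a n hn ha
    have han : AlgFun.evalRep (a ^ n) = AlgFun.evalRep a ^ n := by
      funext x
      simp [AlgFun.evalRep]
    rw [han, Filter.Germ.coe_pow] at ha
    exact .root n hn _ (AlgFun.analyticAt_mvPolynomial_eval AlgFun.analyticAt_rep a) ha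
  · intro a ha
    obtain ⟨q, r, hr, hqr⟩ := AlgFun.exists_rational_of_invariant hx₀ a fun σ hσ => ha ⟨σ, hσ⟩
    rw [Filter.Germ.coe_eq.2 hqr]
    exact .rational q r hr
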